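/- Let $q$ be a prime power and let $n,m$ be integers with $2\le n\le m\le q$. Let $\alpha$ be a primitive element of $\mathbb F_{q^m}$ over $\mathbb F_q$ (that is, $\mathbb F_q(\alpha)=\mathbb F_{q^m}$) and let $U=\langle 1,\alpha,\dots,\alpha^{n-1}\rangle_{\mathbb F_q}$. Let $\mathcal G_{1,1}(0)=\{f_0x : f_0\in\mathbb F_{q^m}\}$. Fix an $\mathbb F_q$-basis $\gamma=(\gamma_1,\dots,\gamma_n)$ of $U$ and an $\mathbb F_q$-basis $\Gamma$ of $\mathbb F_{q^m}$, and regard the Delsarte–Gabidulin code $\pi_U(\mathcal G_{1,1}(0))$ as the matrix code in $\mathbb F_q^{n\times m}$ consisting of the matrices whose $i$-th row is the coordinate vector of $f(\gamma_i)$ with respect to $\Gamma$, for $f\in\mathcal G_{1,1}(0)$. Let $$\mathcal C=\pi_U(\mathcal G_{1,1}(0))^\perp=\{N\in\mathbb F_q^{n\times m} : \operatorname{Tr}(MN^t)=0\text{ for all }M\in\pi_U(\mathcal G_{1,1}(0))\}.$$ The tensor rank $\operatorname{trk}(\mathcal D)$ of a $k$-dimensional subspace $\mathcal D\le\mathbb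 F_q^{n\times m}$ is the least $R$ such that a tensor $X\in\mathbb F_q^{k\times n\times m}$ whose $k$ slices $X_1,\dots,X_k\in\mathbb F_q^{n\times m}$ span $\mathcal D$ is a sum of $R$ simple tensors $u\otimes v\otimes w$ (this does not depend on the choice of $X$). Then, for every choice of the bases $\gamma$ and $\Gamma$, $\operatorname{trk}(\mathcal C)=mn-m+1$. Moreover $\mathcal C$ is MTR (minimal tensor rank), i.e. it meets Kruskal's tensor-rank bound with equality: $\operatorname{trk}(\mathcal C)=\dim_{\mathbb F_q}(\mathcal C)+d(\mathcal C)-1$, where $d(\mathcal C)$ is the least rank of a nonzero matrix in $\mathcal C$. -/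

import Mathlib

open Polynomial

/-- Coordinate 3-tensors `X = (X_1 | ⋯ | X_k)` in `K^{k × n × m}`, given by their
`k` slices, which are `n × m` matrices. -/
abbrev Tensor3 (K : Type*) (k n m : ℕ) := Fin k → Matrix (Fin n) (Fin m) K

namespace Tensor3

variable {K : Type*} [Field K] {k n m : ℕ}

/-- The simple tensor `u ⊗ v ⊗ w`. -/
def simple (u : Fin k → K) (v : Fin n → K) (w : Fin m → K) : Tensor3 K k n m :=
  fun l => Matrix.of fun i j => u l * v i * w j

/-- `X` is a sum of `R` simple tensors. -/
def IsSumOfSimple (X : Tensor3 K k n m) (R : ℕ) : Prop :=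
  ∃ (u : Fin R → Fin k → K) (v : Fin R → Fin n → K) (w : Fin R → Fin m → K),
    X = ∑ r, simple (u r) (v r) (w r)

/-- The tensor rank of a 3-tensor: the least `R` such that it is a sum of `R` simple tensors. -/
noncomputable def trk (X : Tensor3 K k n m) : ℕ := sInf {R | X.IsSumOfSimple R}

/-- The first slice space: the span of the slices. -/
def sliceSpace (X : Tensor3 K k n m) : Submodule K (Matrix (Fin n) (Fin m) K) :=
  Submodule.span K (Set.range X)

/-- `X` is a generator tensor of `V`: it has `dim V` slices, and they span `V`. -/
def IsGenerator (X : Tensor3 K k n m) (V : Submodule K (Matrix (Fin n) (Fin m) K)) : Prop :=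
  k = Module.finrank K V ∧ X.sliceSpace = V

/-- Every tensor is a sum of finitely many simple tensors, so `trk` is a genuine minimum. -/
theorem exists_isSumOfSimple (X : Tensor3 K k n m) : ∃ R, X.IsSumOfSimple R := by
  let e := Fintype.equivFin (Fin k × Fin n × Fin m)
  refine ⟨_, fun r => Pi.single (e.symm r).1 (X (e.symm r).1 (e.symm r).2.1 (e.symm r).2.2),
    fun r => Pi.single (e.symm r).2.1 1, fun r => Pi.single (e.symm r).2.2 1, ?_⟩
  rw [e.symm.sum_comp (fun p : Fin k × Fin n × Fin m =>
    simple (Pi.single p.1 (X p.1 p.2.1 p.2.2)) (Pi.single p.2.1 1) (Pi.single p.2.2 1))]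
  ext l i j
  simp [Finset.sum_apply, Matrix.sum_apply, simple, Fintype.sum_prod_type, Pi.single_apply]

theorem isSumOfSimple_trk (X : Tensor3 K k n m) : X.IsSumOfSimple X.trk :=
  Nat.sInf_mem X.exists_isSumOfSimple

theorem trk_le_of_sliceSpace_le {k' : ℕ} (X : Tensor3 K k n m) (Y : Tensor3 K k' n m)
    (h : X.sliceSpace ≤ Y.sliceSpace) : X.trk ≤ Y.trk := by
  obtain ⟨u, v, w, hY⟩ := Y.isSumOfSimple_trk
  have hc : ∀ l, ∃ c : Fin k' → K, ∑ a, c a • Y a = X l := fun l =>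
    (Submodule.mem_span_range_iff_exists_fun K).1
      (h (Submodule.subset_span (Set.mem_range_self l)))
  choose c hc using hc
  refine Nat.sInf_le ⟨fun r l => ∑ a, c l a * u r a, v, w, ?_⟩
  ext l i j
  have hYa : ∀ a, Y a i j = ∑ r, u r a * v r i * w r j := fun a => by
    have := congrFun (congrFun (congrFun hY a) i) j
    simpa [Finset.sum_apply, Matrix.sum_apply, simple] using this
  rw [← hc l]
  simp only [Matrix.sum_apply, Matrix.smul_apply, smul_eq_mul, hYa, Finset.sum_apply, simple,
    Matrix.of_apply, Finset.mul_sum, Finset.sum_mul]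
  rw [Finset.sum_comm]
  refine Finset.sum_congr rfl fun r _ => Finset.sum_congr rfl fun a _ => by ring

end Tensor3

namespace MatrixCode

variable {K : Type*} [Field K] {n m : ℕ}

/-- A generator tensor of `V`, whose slices are a basis of `V`. -/
noncomputable def generator (V : Submodule K (Matrix (Fin n) (Fin m) K)) :
    Tensor3 K (Module.finrank K V) n m :=
  fun l => (Module.finBasis K V l : Matrix (Fin n) (Fin m) K)

theorem isGenerator_generator (V : Submodule K (Matrix (Fin n) (Fin m) K)) :
    (generator V).IsGenerator V := by
  refine ⟨rfl, ?_⟩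
  have h := congrArg (Submodule.map V.subtype) (Module.finBasis K V).span_eq
  rw [Submodule.map_span, ← Set.range_comp, Submodule.map_top, Submodule.range_subtype] at h
  exact h

/-- The tensor rank of a space of matrices: the tensor rank of a generator tensor. By
`MatrixCode.trk_eq` below it does not depend on the generator tensor. -/
noncomputable def trk (V : Submodule K (Matrix (Fin n) (Fin m) K)) : ℕ :=
  (generator V).trk

theorem trk_eq {k : ℕ} (V : Submodule K (Matrix (Fin n) (Fin m) K)) (X : Tensor3 K k n m)
    (hX : X.IsGenerator V) : X.trk = trk V :=
  le_antisymm
    (X.trk_le_of_sliceSpace_le _ (hX.2.trans (isGenerator_generator V).2.symm).le)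
    (Tensor3.trk_le_of_sliceSpace_le _ X ((isGenerator_generator V).2.trans hX.2.symm).le)

/-- The dual with respect to the trace bilinear form `(M, N) ↦ Tr (M Nᵗ)`. -/
def dual (V : Submodule K (Matrix (Fin n) (Fin m) K)) :
    Submodule K (Matrix (Fin n) (Fin m) K) where
  carrier := {N | ∀ M ∈ V, (M * N.transpose).trace = 0}
  zero_mem' := by
    intro M _
    simp
  add_mem' := by
    intro A B hA hB M hM
    simp [Matrix.mul_add, hA M hM, hB M hM]
  smul_mem' := by
    intro c A hA M hM
    simp [hA M hM]

open Classical in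
/-- The minimum rank distance: the least rank of a nonzero codeword, and `n + 1` for the
zero code. -/
noncomputable def minDist (C : Submodule K (Matrix (Fin n) (Fin m) K)) : ℕ :=
  if C = ⊥ then n + 1 else sInf {d | ∃ X ∈ C, X ≠ 0 ∧ X.rank = d}

/-- Minimal tensor rank: equality in the tensor-rank bound `trk C ≥ dim C + d(C) - 1`. -/
def IsMTR (C : Submodule K (Matrix (Fin n) (Fin m) K)) : Prop :=
  (trk C : ℤ) = Module.finrank K C + minDist C - 1

end MatrixCode

namespace Gabidulin

variable (F : Type*) {L : Type*} [Field F] [Field L] [Algebra F L] {n m : ℕ}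

/-- `𝒢_{k,s}(η)`: the linearized polynomials
`∑_{i < k} f_i x^{q^{s i}} + η f_0 x^{q^{s k}}` with `f_0, …, f_{k-1} ∈ L` and `q = |F|`. -/
noncomputable def polys (k s : ℕ) (η : L) : Submodule L L[X] where
  carrier := {p | ∃ f : ℕ → L,
    p = ∑ i ∈ Finset.range k, C (f i) * X ^ (Nat.card F ^ (s * i))
      + C (η * f 0) * X ^ (Nat.card F ^ (s * k))}
  zero_mem' := ⟨0, by simp⟩
  add_mem' := by
    rintro _ _ ⟨f, rfl⟩ ⟨g, rfl⟩
    refine ⟨f + g, ?_⟩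
    simp only [Pi.add_apply, C_add, mul_add, add_mul, Finset.sum_add_distrib]
    ring
  smul_mem' := by
    rintro c _ ⟨f, rfl⟩
    refine ⟨fun i => c * f i, ?_⟩
    simp only [smul_eq_C_mul, C_mul, mul_add, Finset.mul_sum]
    congr 1
    · exact Finset.sum_congr rfl fun i _ => by ring
    · ring

variable {F}

/-- The evaluation map `π_β : f ↦ Γ(f(β_1), …, f(β_n))`, where `Γ` expands each entry of a
vector in `L^n` as a row of coordinates in the `F`-basis `Γ` of `L`. -/
noncomputable def evalMap (Γ : Module.Basis (Fin m) F L) (β : Fin n → L) :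
    L[X] →ₗ[F] Matrix (Fin n) (Fin m) F where
  toFun f := Matrix.of fun i j => Γ.repr (f.eval (β i)) j
  map_add' f g := by
    ext i j
    simp
  map_smul' c f := by
    ext i j
    simp

/-- The code `π_U(𝒢_{k,s}(η))` as a matrix code in `F^{n × m}`. The class of `f` modulo the
polynomials vanishing on the `n`-dimensional space `U` is represented by the matrix `π_γ(f)`,
where `γ` is an `F`-basis of `U`, and `Γ` is an `F`-basis of `L`. -/
noncomputable def code (Γ : Module.Basis (Fin m) F L) {U : Submodule F L}
    (γ : Module.Basis (Fin n) F U) (k s : ℕ) (η : L) :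
    Submodule F (Matrix (Fin n) (Fin m) F) :=
  ((polys F k s η).restrictScalars F).map (evalMap Γ fun i => (γ i : L))

variable (F)

/-- `U = ⟨1, α, …, α^{n-1}⟩_F`. -/
def powerSpan (n : ℕ) (α : L) : Submodule F L :=
  Submodule.span F (Set.range fun i : Fin n => α ^ (i : ℕ))

end Gabidulin

/-! The code is the kernel of the syndrome map `σ` from matrices onto the dual of `L`, so its
dimension is `mn - m`. A matrix of rank at most one amounts to a pair `u ∈ U`, `l ∈ L*`, with
syndrome `x ↦ l (x u)`. This vanishes only if `u = 0` or `l = 0`, so the kernel has no matrix of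
rank one. Hence `d = 2`, and the tensor rank exceeds the dimension (`finrank_lt_trk`).

For the upper bound, fix `l ≠ 0` and take all matrices of rank at most one with syndrome in the line
of `l`. They span at most `dim + 1` dimensions, and it remains to see that the span contains the
kernel (`ker_syndrome_le_span`). A functional vanishing on the span is a linear map `φ : U → L` with
`l (φ u / u) = 0` for all `u ≠ 0`. Comparing `u = α^i (α - t)` with `u = α^i` for `m` values of `t`,
available since `m ≤ q`, forces `φ u = f u` (`exists_eq_mul_of_forall_div_eq_zero`). The functional
is then `N ↦ σ(N)(f)`, which kills the kernel. -/

theorem Matrix.rank_vecMulVec_sub_le {F : Type*} [Field F] {n m : ℕ}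
    (a b : Fin n → F) (c d : Fin m → F) :
    (Matrix.vecMulVec a c - Matrix.vecMulVec b d).rank ≤ 2 := by
  have h : Matrix.vecMulVec a c - Matrix.vecMulVec b d
      = (Matrix.of fun i => ![a i, b i]) * (Matrix.of ![c, -d]) := by
    ext i j
    simp [Matrix.mul_apply, Matrix.vecMulVec_apply, sub_eq_add_neg]
  rw [h]
  refine (Matrix.rank_mul_le_left _ _).trans ((Matrix.rank_le_card_width _).trans (by simp))

/-! ### Tensor rank through spans of matrices of rank at most one -/

namespace MatrixCode

variable {K : Type*} [Field K] {n m : ℕ}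

/-- With the converse below, this replaces tensors by spans: the coefficients of the slices over the
`v r (w r)ᵗ` are the first factors of the simple tensors. -/
theorem trk_le_of_le_span {R : ℕ} (V : Submodule K (Matrix (Fin n) (Fin m) K))
    (v : Fin R → Fin n → K) (w : Fin R → Fin m → K)
    (h : V ≤ Submodule.span K (Set.range fun r => Matrix.vecMulVec (v r) (w r))) :
    trk V ≤ R := by
  have hc : ∀ l, ∃ c : Fin R → K, ∑ r, c r • Matrix.vecMulVec (v r) (w r) = generator V l :=
    fun l => (Submodule.mem_span_range_iff_exists_fun K).1 (h (Module.finBasis K V l).2)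
  choose c hc using hc
  refine Nat.sInf_le ⟨fun r l => c l r, v, w, ?_⟩
  ext l i j
  simp [← hc l, Matrix.sum_apply, Finset.sum_apply, Tensor3.simple, Matrix.vecMulVec_apply,
    mul_assoc]

theorem exists_le_span_of_trk (V : Submodule K (Matrix (Fin n) (Fin m) K)) :
    ∃ (v : Fin (trk V) → Fin n → K) (w : Fin (trk V) → Fin m → K),
      V ≤ Submodule.span K (Set.range fun r => Matrix.vecMulVec (v r) (w r)) := by
  obtain ⟨u, v, w, h⟩ := (generator V).isSumOfSimple_trk
  refine ⟨v, w, ?_⟩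
  conv_lhs => rw [← (isGenerator_generator V).2]
  refine Submodule.span_le.2 ?_
  rintro _ ⟨l, rfl⟩
  refine (Submodule.mem_span_range_iff_exists_fun K).2 ⟨fun r => u r l, ?_⟩
  rw [h]
  ext i j
  simp only [Matrix.sum_apply, Finset.sum_apply, Tensor3.simple, Matrix.vecMulVec_apply,
    Matrix.smul_apply, Matrix.of_apply, smul_eq_mul, mul_assoc]
  rfl

/-- The dimension of a space spanned by rank-one matrices bounds the tensor rank of its subspaces. -/
theorem trk_le_finrank_span (V : Submodule K (Matrix (Fin n) (Fin m) K))
    (S : Set ((Fin n → K) × (Fin m → K)))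
    (h : V ≤ Submodule.span K ((fun p => Matrix.vecMulVec p.1 p.2) '' S)) :
    trk V ≤ Module.finrank K
      (Submodule.span K ((fun p : (Fin n → K) × (Fin m → K) => Matrix.vecMulVec p.1 p.2) '' S)) := by
  obtain ⟨f, hf, hspan, -⟩ := Submodule.exists_fun_fin_finrank_span_eq K
    ((fun p : (Fin n → K) × (Fin m → K) => Matrix.vecMulVec p.1 p.2) '' S)
  choose p hp using hf
  refine trk_le_of_le_span V (fun r => (p r).1) (fun r => (p r).2) ?_
  simp only [(hp _).2]
  rwa [hspan]

/-- A nonzero code without matrices of rank one has tensor rank greater than its dimension. -/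
theorem finrank_lt_trk (V : Submodule K (Matrix (Fin n) (Fin m) K)) (hV : V ≠ ⊥)
    (h : ∀ v w, Matrix.vecMulVec v w ∈ V → Matrix.vecMulVec v w = 0) :
    Module.finrank K V < trk V := by
  obtain ⟨v, w, hle⟩ := exists_le_span_of_trk V
  by_contra! hlt
  have hcard := finrank_range_le_card (R := K) fun r => Matrix.vecMulVec (v r) (w r)
  rw [Fintype.card_fin] at hcard
  -- By dimension the code equals the span, so it contains the spanning matrices, which must then
  -- all vanish.
  have heq := Submodule.eq_of_le_of_finrank_le hle (hcard.trans hlt)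
  apply hV
  rw [heq, Submodule.span_eq_bot]
  rintro _ ⟨r, rfl⟩
  refine h _ _ ?_
  rw [heq]
  exact Submodule.subset_span ⟨r, rfl⟩

theorem two_le_rank (V : Submodule K (Matrix (Fin n) (Fin m) K))
    (h : ∀ v w, Matrix.vecMulVec v w ∈ V → Matrix.vecMulVec v w = 0)
    {N : Matrix (Fin n) (Fin m) K} (hN : N ∈ V) (hN0 : N ≠ 0) : 2 ≤ N.rank := by
  by_contra! hlt
  obtain ⟨v, hv⟩ := finrank_le_one_iff.1 (Nat.lt_succ_iff.1 hlt)
  choose c hc using fun j => hv ⟨_, LinearMap.mem_range_self N.mulVecLin (Pi.single j 1)⟩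
  have hNv : N = Matrix.vecMulVec (v : Fin n → K) c := by
    ext i j
    have := congrFun (congrArg Subtype.val (hc j)) i
    simp only [Submodule.coe_smul, Pi.smul_apply, smul_eq_mul, Matrix.mulVecLin_apply,
      Matrix.mulVec_single_one, Matrix.col_apply] at this
    rw [Matrix.vecMulVec_apply, ← this, mul_comm]
  rw [hNv] at hN hN0
  exact hN0 (h _ _ hN)

theorem minDist_eq_two (V : Submodule K (Matrix (Fin n) (Fin m) K))
    (h : ∀ v w, Matrix.vecMulVec v w ∈ V → Matrix.vecMulVec v w = 0)
    {N : Matrix (Fin n) (Fin m) K} (hN : N ∈ V) (hN0 : N ≠ 0) (hr : N.rank ≤ 2) :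
    minDist V = 2 := by
  have hV : V ≠ ⊥ := fun hV => hN0 (by simpa [hV] using hN)
  rw [minDist, if_neg hV]
  refine le_antisymm (Nat.sInf_le ⟨N, hN, hN0, hr.antisymm (two_le_rank V h hN hN0)⟩) ?_
  refine le_csInf ⟨_, N, hN, hN0, rfl⟩ ?_
  rintro _ ⟨M, hM, hM0, rfl⟩
  exact two_le_rank V h hM hM0

end MatrixCode

/-! ### Rigidity of linear maps on the span of powers of `α` -/

section PrimitiveElement

variable {F L : Type*} [Field F] [Field L] [Algebra F L]

/-- The inverses of `α - t`, for `t` among `[F(α) : F]` distinct elements of `F`, are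
linearly independent over `F`. -/
theorem linearIndependent_inv_sub {m : ℕ} {α : L} (hm : (minpoly F α).natDegree = m)
    (hne : ∀ t : F, α - algebraMap F L t ≠ 0) {t : Fin m → F} (ht : Function.Injective t) :
    LinearIndependent F fun i => (α - algebraMap F L (t i))⁻¹ := by
  rw [Fintype.linearIndependent_iff]
  intro s hs k
  -- The relation with denominators cleared: `p` has root `α` but degree below that of the minimal
  -- polynomial, so `p = 0`. Its value at `t k` isolates `s k`.
  set p : F[X] := ∑ i, C (s i) * ∏ j ∈ Finset.univ.erase i, (X - C (t j)) with hp
  have hp0 : aeval α p = 0 := by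
    have : aeval α p = (∏ j, (α - algebraMap F L (t j))) *
        ∑ i, s i • (α - algebraMap F L (t i))⁻¹ := by
      rw [hp, map_sum, Finset.mul_sum]
      refine Finset.sum_congr rfl fun i _ => ?_
      rw [← Finset.mul_prod_erase _ _ (Finset.mem_univ i), map_mul, map_prod, Algebra.smul_def]
      have := hne (t i)
      simp only [map_sub, aeval_C, aeval_X]
      field_simp
    rw [this, hs, mul_zero]
  have hm0 : 0 < m := k.pos
  have hdeg : p.natDegree < m := by
    refine lt_of_le_of_lt (natDegree_sum_le_of_forall_le (n := m - 1) _ _ fun i _ => ?_)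
      (Nat.sub_lt hm0 one_pos)
    refine (natDegree_C_mul_le _ _).trans ?_
    rw [natDegree_prod_of_monic _ _ fun j _ => monic_X_sub_C _]
    simp
  have hz : p = 0 := eq_zero_of_dvd_of_natDegree_lt (minpoly.dvd F α hp0) (by omega)
  have hev := congrArg (eval (t k)) hz
  rw [hp, eval_finsetSum, Finset.sum_eq_single k] at hev
  · simp only [eval_mul, eval_C, eval_prod, eval_sub, eval_X, eval_zero, mul_eq_zero,
      Finset.prod_eq_zero_iff] at hev
    refine hev.resolve_right ?_
    rintro ⟨j, hj, hj'⟩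
    exact (Finset.ne_of_mem_erase hj) (ht (sub_eq_zero.1 hj')).symm
  · intro i _ hik
    rw [eval_mul, eval_prod, Finset.prod_eq_zero (Finset.mem_erase.2 ⟨hik.symm, Finset.mem_univ k⟩),
      mul_zero]
    simp
  · simp

/-- A linear map `φ` on `⟨1, α, …, α^{n-1}⟩` for which a fixed nonzero functional kills all
quotients `φ u / u` is multiplication by a scalar. -/
theorem exists_eq_mul_of_forall_div_eq_zero {n m : ℕ} {α : L}
    (hn : 0 < n) (hm2 : 2 ≤ m) (hm : (minpoly F α).natDegree = m)
    (hL : Module.finrank F L = m) {t : Fin m → F} (ht : Function.Injective t)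
    {l : L →ₗ[F] F} (hl : l ≠ 0) (φ : Gabidulin.powerSpan F n α →ₗ[F] L)
    (hφ : ∀ u : Gabidulin.powerSpan F n α, u ≠ 0 → l (φ u / u) = 0) :
    ∃ f : L, ∀ u : Gabidulin.powerSpan F n α, φ u = f * u := by
  have : Nonempty (Fin m) := ⟨⟨0, by omega⟩⟩
  have hne : ∀ t : F, α - algebraMap F L t ≠ 0 := by
    intro t h
    rw [sub_eq_zero.1 h, minpoly.eq_X_sub_C, natDegree_X_sub_C] at hm
    omega
  have hα0 : α ≠ 0 := by simpa using hne 0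
  have hmem : ∀ i, i < n → α ^ i ∈ Gabidulin.powerSpan F n α :=
    fun i hi => Submodule.subset_span ⟨⟨i, hi⟩, rfl⟩
  have hspan := (linearIndependent_inv_sub hm hne ht).span_eq_top_of_card_eq_finrank
    (by simp [hL])
  have hstep : ∀ i (hi : i + 1 < n),
      φ ⟨α ^ (i + 1), hmem _ hi⟩ = α * φ ⟨α ^ i, hmem _ (by omega)⟩ := by
    intro i hi
    set a : Gabidulin.powerSpan F n α := ⟨α ^ i, hmem _ (by omega)⟩ with ha
    set b : Gabidulin.powerSpan F n α := ⟨α ^ (i + 1), hmem _ hi⟩ with hb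
    have hpow : α ^ i ≠ 0 := pow_ne_zero _ hα0
    have ha0 : a ≠ 0 := fun h => hpow (congrArg Subtype.val h)
    -- The defect of `φ` from commuting with multiplication by `α`. The quotient `φ u / u` at `u = b
    -- - t a` minus that at `u = a` is exactly `c / (α - t)`.
    set c : L := (φ b - α * φ a) / α ^ i with hc
    have hker : ∀ k, l (c * (α - algebraMap F L (t k))⁻¹) = 0 := by
      intro k
      have hval : ((b - t k • a : Gabidulin.powerSpan F n α) : L)
          = α ^ i * (α - algebraMap F L (t k)) := by
        simp only [ha, hb, Submodule.coe_sub, Submodule.coe_smul, Algebra.smul_def]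
        ring
      have hk := hne (t k)
      have h0 : b - t k • a ≠ 0 := fun h => by
        rw [h] at hval
        exact mul_ne_zero hpow hk hval.symm
      have h1 := hφ _ h0
      have h2 := hφ a ha0
      have : c * (α - algebraMap F L (t k))⁻¹ =
          φ (b - t k • a) / ((b - t k • a : Gabidulin.powerSpan F n α) : L) - φ a / a := by
        rw [hval, hc, map_sub, map_smul, Algebra.smul_def]
        simp only [ha]
        field_simp
        ring
      rw [this, map_sub, h1, h2, sub_zero]
    -- The `m` inverses `(α - t k)⁻¹` form a basis of `L`.
    have hall : ∀ x, l (c * x) = 0 := by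
      have : l ∘ₗ LinearMap.mulLeft F c = 0 :=
        LinearMap.ext_on_range hspan fun k => by simpa using hker k
      exact fun x => LinearMap.congr_fun this x
    have hc0 : c = 0 := by
      by_contra h
      refine hl (LinearMap.ext fun x => ?_)
      simpa [mul_inv_cancel_left₀ h] using hall (c⁻¹ * x)
    rw [hc, div_eq_zero_iff] at hc0
    exact sub_eq_zero.1 (hc0.resolve_right hpow)
  refine ⟨φ ⟨α ^ 0, hmem 0 hn⟩, ?_⟩
  have hpows : ∀ i (hi : i < n), φ ⟨α ^ i, hmem i hi⟩ = φ ⟨α ^ 0, hmem 0 hn⟩ * α ^ i := by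
    intro i
    induction i with
    | zero => intro _; simp
    | succ i ih =>
      intro hi
      rw [hstep i hi, ih (by omega)]
      ring
  rintro ⟨u, hu⟩
  unfold Gabidulin.powerSpan at hu
  induction hu using Submodule.span_induction with
  | mem x hx =>
    obtain ⟨i, rfl⟩ := hx
    exact hpows i i.2
  | zero => exact (map_zero φ).trans (mul_zero _).symm
  | add x y hx hy h1 h2 =>
    have : (⟨x + y, Submodule.add_mem _ hx hy⟩ : Gabidulin.powerSpan F n α)
      = ⟨x, hx⟩ + ⟨y, hy⟩ := rfl
    rw [this, map_add, h1, h2]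
    simp [mul_add]
  | smul c x hx h =>
    have : (⟨c • x, Submodule.smul_mem _ c hx⟩ : Gabidulin.powerSpan F n α)
      = c • ⟨x, hx⟩ := rfl
    rw [this, map_smul, h]
    simp

end PrimitiveElement

/-! ### The syndrome map and its kernel -/

namespace Gabidulin

variable {F L : Type*} [Field F] [Field L] [Algebra F L] {n m : ℕ}

/-- The syndrome of `N`: the functional `x ↦ Tr (M_x Nᵗ)`, where `M_x` is the codeword
of the polynomial `x X`. -/
noncomputable def syndrome (Γ : Module.Basis (Fin m) F L) (β : Fin n → L) :
    Matrix (Fin n) (Fin m) F →ₗ[F] Module.Dual F L where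
  toFun N := ∑ i, ∑ j, N i j • (Γ.coord j ∘ₗ LinearMap.mulRight F (β i))
  map_add' A B := by simp [add_smul, Finset.sum_add_distrib]
  map_smul' c A := by simp [Finset.smul_sum, mul_smul]

theorem syndrome_apply (Γ : Module.Basis (Fin m) F L) (β : Fin n → L)
    (N : Matrix (Fin n) (Fin m) F) (x : L) :
    syndrome Γ β N x = ∑ i, ∑ j, N i j * Γ.repr (x * β i) j := by
  simp [syndrome]

theorem dual_code_eq_ker (Γ : Module.Basis (Fin m) F L) {U : Submodule F L}
    (γ : Module.Basis (Fin n) F U) :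
    MatrixCode.dual (code Γ γ 1 1 0) = LinearMap.ker (syndrome Γ fun i => (γ i : L)) := by
  have key : ∀ (x : L) (N : Matrix (Fin n) (Fin m) F),
      (evalMap Γ (fun i => (γ i : L)) (C x * X) * N.transpose).trace
        = syndrome Γ (fun i => (γ i : L)) N x := by
    intro x N
    rw [syndrome_apply, Matrix.trace]
    refine Finset.sum_congr rfl fun i _ => ?_
    rw [Matrix.diag_apply, Matrix.mul_apply]
    refine Finset.sum_congr rfl fun j _ => ?_
    simp [evalMap, mul_comm (N i j)]
  ext N
  rw [LinearMap.mem_ker]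
  constructor
  · intro h
    ext x
    rw [← key]
    exact h _ ⟨C x * X, ⟨fun _ => x, by simp⟩, rfl⟩
  · rintro h _ ⟨_, ⟨f, rfl⟩, rfl⟩
    have := key (f 0) N
    rw [h] at this
    simpa using this

theorem syndrome_vecMulVec (Γ : Module.Basis (Fin m) F L) (β : Fin n → L)
    (v : Fin n → F) (w : Fin m → F) (x : L) :
    syndrome Γ β (Matrix.vecMulVec v w) x = ∑ j, w j * Γ.repr (x * ∑ i, v i • β i) j := by
  rw [syndrome_apply, Finset.sum_comm]
  refine Finset.sum_congr rfl fun j _ => ?_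
  simp only [Finset.mul_sum, map_sum, Finsupp.coe_finsetSum, Finset.sum_apply, mul_smul_comm,
    map_smul, Finsupp.smul_apply, smul_eq_mul, Matrix.vecMulVec_apply]
  refine Finset.sum_congr rfl fun i _ => by ring

theorem sum_apply_basis_mul_repr (Γ : Module.Basis (Fin m) F L) (l : Module.Dual F L) (y : L) :
    ∑ j, l (Γ j) * Γ.repr y j = l y := by
  conv_rhs => rw [← Γ.sum_repr y, map_sum]
  simp only [map_smul, smul_eq_mul, mul_comm]

theorem syndrome_vecMulVec_dual (Γ : Module.Basis (Fin m) F L) (β : Fin n → L)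
    (v : Fin n → F) (l : Module.Dual F L) (x : L) :
    syndrome Γ β (Matrix.vecMulVec v fun j => l (Γ j)) x = l (x * ∑ i, v i • β i) := by
  rw [syndrome_vecMulVec, sum_apply_basis_mul_repr]

theorem vecMulVec_eq_zero_of_syndrome (Γ : Module.Basis (Fin m) F L) {β : Fin n → L}
    (hβ : LinearIndependent F β) (v : Fin n → F) (w : Fin m → F)
    (h : syndrome Γ β (Matrix.vecMulVec v w) = 0) : Matrix.vecMulVec v w = 0 := by
  by_cases hu : ∑ i, v i • β i = 0
  · have : v = 0 := funext (Fintype.linearIndependent_iff.1 hβ v hu)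
    simp [this]
  · have : w = 0 := by
      ext k
      have := LinearMap.congr_fun h (Γ k * (∑ i, v i • β i)⁻¹)
      rw [syndrome_vecMulVec, inv_mul_cancel_right₀ hu] at this
      simpa [Finsupp.single_apply] using this
    ext i j
    simp [this, Matrix.vecMulVec_apply]

theorem syndrome_surjective (Γ : Module.Basis (Fin m) F L) {β : Fin n → L} {i : Fin n}
    (hi : β i ≠ 0) : Function.Surjective (syndrome Γ β) := by
  intro l
  refine ⟨Matrix.vecMulVec (Pi.single i 1)
    fun j => (l ∘ₗ LinearMap.mulRight F (β i)⁻¹) (Γ j), LinearMap.ext fun x => ?_⟩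
  rw [syndrome_vecMulVec_dual]
  simp [Pi.single_apply, hi]

theorem finrank_ker_syndrome (Γ : Module.Basis (Fin m) F L) {β : Fin n → L} {i : Fin n}
    (hi : β i ≠ 0) : Module.finrank F (LinearMap.ker (syndrome Γ β)) + m = n * m := by
  have : FiniteDimensional F L := Γ.finiteDimensional_of_finite
  have h := (syndrome Γ β).finrank_range_add_finrank_ker
  rw [LinearMap.range_eq_top.2 (syndrome_surjective Γ hi), finrank_top,
    Subspace.dual_finrank_eq, Module.finrank_eq_card_basis Γ, Module.finrank_matrix] at h
  simp at h
  omega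

theorem exists_ker_syndrome_rank_le_two (Γ : Module.Basis (Fin m) F L) {β : Fin n → L}
    {i k : Fin n} (hik : i ≠ k) (hi : β i ≠ 0) {l : Module.Dual F L} (hl : l ≠ 0) :
    ∃ N ∈ LinearMap.ker (syndrome Γ β), N ≠ 0 ∧ N.rank ≤ 2 := by
  -- Both terms have syndrome `x ↦ l (x * β k)`.
  refine ⟨Matrix.vecMulVec (Pi.single k 1) (fun j => l (Γ j)) - Matrix.vecMulVec (Pi.single i 1)
    (fun j => (l ∘ₗ LinearMap.mulRight F (β k / β i)) (Γ j)), ?_, ?_, ?_⟩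
  · rw [LinearMap.mem_ker, map_sub, sub_eq_zero]
    ext x
    rw [syndrome_vecMulVec_dual, syndrome_vecMulVec_dual]
    simp only [Pi.single_apply, ite_smul, one_smul, zero_smul, Finset.sum_ite_eq',
      Finset.mem_univ, if_true, LinearMap.comp_apply, LinearMap.mulRight_apply]
    congr 1
    field_simp
  · intro h
    refine hl (Γ.ext fun j => ?_)
    have := congrFun (congrFun h k) j
    simpa [Matrix.vecMulVec_apply, Pi.single_apply, hik.symm] using this
  · exact Matrix.rank_vecMulVec_sub_le _ _ _ _

/-- The pairs `(v, w)` for which the syndrome of `v wᵗ` is a multiple of `l`. -/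
def syndromeLinePairs (Γ : Module.Basis (Fin m) F L) (β : Fin n → L) (l : Module.Dual F L) :
    Set ((Fin n → F) × (Fin m → F)) :=
  {p | syndrome Γ β (Matrix.vecMulVec p.1 p.2) ∈ Submodule.span F {l}}

/-- The span lies in the preimage of a line, which exceeds the kernel by at most one dimension. -/
theorem finrank_span_syndromeLinePairs_le (Γ : Module.Basis (Fin m) F L) {β : Fin n → L}
    (l : Module.Dual F L) :
    Module.finrank F (Submodule.span F ((fun p : (Fin n → F) × (Fin m → F) =>
      Matrix.vecMulVec p.1 p.2) '' syndromeLinePairs Γ β l))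
      ≤ Module.finrank F (LinearMap.ker (syndrome Γ β)) + 1 := by
  have : FiniteDimensional F L := Γ.finiteDimensional_of_finite
  set W := (Submodule.span F {l}).comap (syndrome Γ β) with hW
  have hle : Submodule.span F ((fun p : (Fin n → F) × (Fin m → F) =>
      Matrix.vecMulVec p.1 p.2) '' syndromeLinePairs Γ β l) ≤ W := by
    rw [Submodule.span_le]
    rintro _ ⟨p, hp, rfl⟩
    exact hp
  refine (Submodule.finrank_mono hle).trans ?_
  have h := ((syndrome Γ β).domRestrict W).finrank_range_add_finrank_ker
  have h1 : Module.finrank F (LinearMap.range ((syndrome Γ β).domRestrict W)) ≤ 1 := by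
    refine (Submodule.finrank_mono (t := Submodule.span F {l}) ?_).trans
      ((finrank_span_le_card _).trans (by simp))
    rintro _ ⟨x, rfl⟩
    exact x.2
  have h2 : Module.finrank F (LinearMap.ker ((syndrome Γ β).domRestrict W))
      ≤ Module.finrank F (LinearMap.ker (syndrome Γ β)) := by
    rw [← Submodule.finrank_map_subtype_eq W (LinearMap.ker ((syndrome Γ β).domRestrict W))]
    refine Submodule.finrank_mono ?_
    rintro _ ⟨x, hx, rfl⟩
    exact hx
  omega

theorem ker_syndrome_le_span {α : L} (hn : 0 < n) (hm2 : 2 ≤ m)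
    (hm : (minpoly F α).natDegree = m) {t : Fin m → F} (ht : Function.Injective t)
    (Γ : Module.Basis (Fin m) F L) (γ : Module.Basis (Fin n) F (powerSpan F n α))
    {l : Module.Dual F L} (hl : l ≠ 0) :
    LinearMap.ker (syndrome Γ fun i => (γ i : L)) ≤
      Submodule.span F ((fun p : (Fin n → F) × (Fin m → F) =>
        Matrix.vecMulVec p.1 p.2) '' syndromeLinePairs Γ (fun i => (γ i : L)) l) := by
  intro N hN
  by_contra hNW
  -- Duality: a functional separating `N` from the span will turn out to factor through the
  -- syndrome.
  obtain ⟨Φ, hΦN, hΦ⟩ := Submodule.exists_dual_map_eq_bot_of_notMem hNW inferInstance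
  have hΦ0 : ∀ p ∈ syndromeLinePairs Γ (fun i => (γ i : L)) l,
      Φ (Matrix.vecMulVec p.1 p.2) = 0 := by
    intro p hp
    have : Φ (Matrix.vecMulVec p.1 p.2) ∈ Submodule.map Φ (Submodule.span F
      ((fun p : (Fin n → F) × (Fin m → F) =>
        Matrix.vecMulVec p.1 p.2) '' syndromeLinePairs Γ (fun i => (γ i : L)) l)) :=
      ⟨_, Submodule.subset_span ⟨p, hp, rfl⟩, rfl⟩
    rwa [hΦ, Submodule.mem_bot] at this
  set a : Fin n → Fin m → F := fun i j => Φ (Matrix.single i j 1) with ha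
  have hΦa : ∀ M : Matrix (Fin n) (Fin m) F, Φ M = ∑ i, ∑ j, M i j * a i j := by
    intro M
    conv_lhs => rw [Matrix.matrix_eq_sum_single M]
    simp only [map_sum, ha]
    refine Finset.sum_congr rfl fun i _ => Finset.sum_congr rfl fun j _ => ?_
    rw [← smul_eq_mul, ← map_smul, Matrix.smul_single, smul_eq_mul, mul_one]
  set φ : powerSpan F n α →ₗ[F] L := γ.constr F fun i => ∑ j, a i j • Γ j with hφ
  have hφγ : ∀ i, φ (γ i) = ∑ j, a i j • Γ j := fun i => by rw [hφ, Module.Basis.constr_basis]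
  obtain ⟨f, hf⟩ := exists_eq_mul_of_forall_div_eq_zero hn hm2 hm
    (by simp [Module.finrank_eq_card_basis Γ]) ht hl φ (by
      intro u hu
      have hu0 : (u : L) ≠ 0 := fun h => hu (Subtype.ext h)
      have hsum : ∑ i, γ.repr u i • (γ i : L) = u := by
        simpa only [Submodule.coe_sum, Submodule.coe_smul] using
          congrArg Subtype.val (γ.sum_repr u)
      -- The pair of `u` and `x ↦ l (x / u)` has syndrome exactly `l`.
      have h0 := hΦ0 (fun i => γ.repr u i,
        fun j => (l ∘ₗ LinearMap.mulRight F (u : L)⁻¹) (Γ j)) (by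
          refine Submodule.mem_span_singleton.2 ⟨1, LinearMap.ext fun x => ?_⟩
          rw [syndrome_vecMulVec_dual, hsum]
          simp [hu0])
      rw [hΦa] at h0
      have hφu : φ u = ∑ i, γ.repr u i • ∑ j, a i j • Γ j := by
        conv_lhs => rw [← γ.sum_repr u, map_sum]
        simp only [map_smul, hφγ]
      rw [hφu, ← h0]
      simp only [Finset.sum_div, Finset.smul_sum, map_sum, Matrix.vecMulVec_apply,
        LinearMap.comp_apply, LinearMap.mulRight_apply, smul_smul]
      refine Finset.sum_congr rfl fun i _ => Finset.sum_congr rfl fun j _ => ?_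
      rw [smul_div_assoc, map_smul, div_eq_mul_inv, smul_eq_mul]
      ring)
  apply hΦN
  have hs := syndrome_apply Γ (fun i => (γ i : L)) N f
  rw [LinearMap.mem_ker.1 hN, LinearMap.zero_apply] at hs
  rw [hΦa, hs]
  refine Finset.sum_congr rfl fun i _ => Finset.sum_congr rfl fun j _ => ?_
  rw [← hf, hφγ, Γ.repr_sum_self]

end Gabidulin

/-! ### The tensor rank of the dual code -/

theorem mainTheorem2 {F L : Type*} [Field F] [Finite F] [Field L] [Algebra F L]
    (n m : ℕ) (hn : 2 ≤ n) (hnm : n ≤ m) (hq : m ≤ Nat.card F)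
    (α : L) (hα : IntermediateField.adjoin F {α} = ⊤)
    (Γ : Module.Basis (Fin m) F L)
    (γ : Module.Basis (Fin n) F (Gabidulin.powerSpan F n α)) :
    (MatrixCode.trk (MatrixCode.dual (Gabidulin.code Γ γ 1 1 0)) : ℤ) = m * n - m + 1 ∧
      MatrixCode.IsMTR (MatrixCode.dual (Gabidulin.code Γ γ 1 1 0)) := by
  have : FiniteDimensional F L := Γ.finiteDimensional_of_finite
  have hL : Module.finrank F L = m := by simp [Module.finrank_eq_card_basis Γ]
  have hm : (minpoly F α).natDegree = m := by
    rw [← hL]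
    exact (Field.primitive_element_iff_minpoly_natDegree_eq F α).1 hα
  have : Fintype F := Fintype.ofFinite F
  obtain ⟨t⟩ : Nonempty (Fin m ↪ F) := by
    rw [Nat.card_eq_fintype_card] at hq
    exact Function.Embedding.nonempty_of_card_le (by simpa using hq)
  have hβ : LinearIndependent F fun i => (γ i : L) :=
    γ.linearIndependent.map' (Gabidulin.powerSpan F n α).subtype (Submodule.ker_subtype _)
  -- Any nonzero functional serves as `l`; a coordinate is at hand.
  have hl : Γ.coord ⟨0, by omega⟩ ≠ 0 := fun h => by
    have := LinearMap.congr_fun h (Γ ⟨0, by omega⟩)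
    simp at this
  let i₀ : Fin n := ⟨0, by omega⟩
  let i₁ : Fin n := ⟨1, by omega⟩
  have hi₀ : (γ i₀ : L) ≠ 0 := hβ.ne_zero i₀
  have hdim := Gabidulin.finrank_ker_syndrome Γ (β := fun i => (γ i : L)) hi₀
  obtain ⟨N, hN, hN0, hNr⟩ := Gabidulin.exists_ker_syndrome_rank_le_two Γ
    (β := fun i => (γ i : L)) (i := i₀) (k := i₁) (by simp [i₀, i₁]) hi₀ hl
  have hrank := fun v w => Gabidulin.vecMulVec_eq_zero_of_syndrome Γ hβ v w
  have hupper := (MatrixCode.trk_le_finrank_span _ _ (Gabidulin.ker_syndrome_le_span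
    (by omega) (by omega) hm t.injective Γ γ hl)).trans
    (Gabidulin.finrank_span_syndromeLinePairs_le Γ _)
  have hlower := MatrixCode.finrank_lt_trk (LinearMap.ker
    (Gabidulin.syndrome Γ fun i => (γ i : L)))
    (fun h => hN0 (by simpa [h] using hN)) hrank
  rw [MatrixCode.IsMTR, Gabidulin.dual_code_eq_ker,
    MatrixCode.minDist_eq_two _ hrank hN hN0 hNr]
  have hdim' : (Module.finrank F (LinearMap.ker (Gabidulin.syndrome Γ fun i => (γ i : L))) : ℤ)
      + m = n * m := by exact_mod_cast hdim
  constructor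
  · rw [mul_comm (m : ℤ) n]
    omega
  · omega
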